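/- Let $-1<\rho<1$ and let $(X,Y)$ be a pair of real random variables on a probability space with $(X,Y)\sim N\left(0,\begin{pmatrix}1&\rho\\ \rho&1\end{pmatrix}\right)$. For $\alpha\in\mathbb{R}$ let $g_\alpha(x,y)=\dfrac{y}{1+e^{\alpha-x}}$ be the sigmoidal switch kernel and let $T_\alpha=g_\alpha(X,Y)$ (a normalized Gaussian noise-free bivariate interaction). Write $p$ for Lebesgue densities and $\log$ for the natural logarithm, and put, for $Z\in\{X,Y\}$ and a target $T$, $$I(T;Z)=\mathbb{E}\log\frac{p_{Z,T}(Z,T)}{p_Z(Z)\,p_T(T)},\qquad I_Z(t)=\mathbb{E}\left[\log\frac{p_{Z,T}(Z,T)}{p_Z(Z)\,p_T(T)}\,\middle|\,T=t\right].$$ The unique information of $X$ in the $\min$-decomposition is $$U_X^{\min}=I(T;X)-\mathbb{E}\min\big(I_X(T),I_Y(T)\big).$$ The unique specificity, unique ambiguity and unique information of $X$ in the $\mathrm{PM}$-decomposition are $$U_X^{\mathrm{PM},+}=\mathbb{E}\log\frac1{p_X(X)}-\mathbb{E}\min\Big(\log\frac1{p_X(X)},\log\frac1{p_Y(Y)}\Big),$$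 $$U_X^{\mathrm{PM},-}=\mathbb{E}\log\frac1{p_{X|T}(X|T)}-\mathbb{E}\min\Big(\log\frac1{p_{X|T}(X|T)},\log\frac1{p_{Y|T}(Y|T)}\Big),\qquad U_X^{\mathrm{PM}}=U_X^{\mathrm{PM},+}-U_X^{\mathrm{PM},-}.$$ Then for every $\alpha\in\mathbb{R}$ and $T=T_\alpha$ all these densities exist and all these expectations are finite, and, writing $U(\alpha)$ for the quantity $U$ with $T=T_\alpha$, $$U_X^{\min}(\alpha)\to 0,\qquad U_X^{\mathrm{PM},-}(\alpha)\to+\infty,\qquad U_X^{\mathrm{PM}}(\alpha)\to-\infty\qquad\text{as }\alpha\to-\infty.$$ -/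

import Mathlib

open MeasureTheory ProbabilityTheory Filter Topology

noncomputable section

namespace ContinuousPID

variable {Ω : Type*} [MeasurableSpace Ω]

/-! ### Noise-free bivariate interactions -/

/-- `(X, Y, T)` is a noise-free bivariate interaction with kernel `g`: `X`, `Y` are real random
variables, `g` is continuous, and `T = g (X, Y)` for every outcome. -/
structure IsNoiseFreeInteraction (g : ℝ → ℝ → ℝ) (X Y T : Ω → ℝ) : Prop where
  measurable_left : Measurable X
  measurable_right : Measurable Y
  continuous_kernel : Continuous fun z : ℝ × ℝ => g z.1 z.2
  target_eq : ∀ ω, T ω = g (X ω) (Y ω)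

/-- The pair `(X, Y)` has the bivariate normal law with mean `(0, 0)` and covariance matrix
`(1, ρ; ρ, 1)`. -/
structure IsNormalizedGaussianPair (P : Measure Ω) (ρ : ℝ) (X Y : Ω → ℝ) : Prop where
  gaussian : HasGaussianLaw (fun ω => (X ω, Y ω)) P
  mean_left : ∫ ω, X ω ∂P = 0
  mean_right : ∫ ω, Y ω ∂P = 0
  variance_left : variance X P = 1
  variance_right : variance Y P = 1
  covariance_eq : covariance X Y P = ρ

/-- The sigmoidal switch kernel `g_α(x, y) = y / (1 + e^(α - x))`. -/
def sigmoidalSwitch (α x y : ℝ) : ℝ := y / (1 + Real.exp (α - x))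

theorem continuous_sigmoidalSwitch (α : ℝ) :
    Continuous fun z : ℝ × ℝ => sigmoidalSwitch α z.1 z.2 := by
  unfold sigmoidalSwitch
  exact continuous_snd.div (by fun_prop) fun z => by positivity

/-! ### Densities and pointwise information quantities (in nats) -/

/-- The Lebesgue density `p_X` of a real random variable, as a real-valued function. -/
def density (P : Measure Ω) (X : Ω → ℝ) (x : ℝ) : ℝ :=
  (pdf X P volume x).toReal

/-- The joint Lebesgue density `p_{X,T}` of two real random variables. -/
def jointDensity (P : Measure Ω) (X T : Ω → ℝ) (x t : ℝ) : ℝ :=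
  (pdf (fun ω => (X ω, T ω)) P volume (x, t)).toReal

/-- The conditional density `p_{X|T}(x | t) = p_{X,T}(x, t) / p_T(t)`. -/
def condDensity (P : Measure Ω) (X T : Ω → ℝ) (x t : ℝ) : ℝ :=
  jointDensity P X T x t / density P T t

/-- Pointwise mutual information `log (p_{X,T}(x, t) / (p_X(x) p_T(t)))`. -/
def pointwiseInfo (P : Measure Ω) (X T : Ω → ℝ) (x t : ℝ) : ℝ :=
  Real.log (jointDensity P X T x t / (density P X x * density P T t))

/-- Pointwise entropy (specificity) `log (1 / p_X(x))`. -/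
def pointwiseEntropy (P : Measure Ω) (X : Ω → ℝ) (x : ℝ) : ℝ :=
  Real.log (1 / density P X x)

/-- Pointwise conditional entropy (ambiguity) `log (1 / p_{X|T}(x | t))`. -/
def pointwiseCondEntropy (P : Measure Ω) (X T : Ω → ℝ) (x t : ℝ) : ℝ :=
  Real.log (1 / condDensity P X T x t)

/-- Mutual information `I(T; X) = E [log (p_{X,T}(X, T) / (p_X(X) p_T(T)))]`. -/
def mutualInfo (P : Measure Ω) (X T : Ω → ℝ) : ℝ :=
  ∫ ω, pointwiseInfo P X T (X ω) (T ω) ∂P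

/-- Specific information `I_X(t) = E [log (p_{X,T}(X, T) / (p_X(X) p_T(T))) | T = t]`, the
expectation being taken under the regular conditional distribution of `X` given `T = t`. -/
def specificInfo (P : Measure Ω) [IsFiniteMeasure P] (X T : Ω → ℝ) (t : ℝ) : ℝ :=
  ∫ x, pointwiseInfo P X T x t ∂(condDistrib X T P t)

/-! ### The `min` decomposition -/

/-- Redundant information `E [min (I_X(T), I_Y(T))]`. -/
def redundancyMin (P : Measure Ω) [IsFiniteMeasure P] (X Y T : Ω → ℝ) : ℝ :=
  ∫ ω, min (specificInfo P X T (T ω)) (specificInfo P Y T (T ω)) ∂P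

/-- Unique information of `X` in the `min` decomposition: `I(T; X)` minus the redundancy. -/
def uniqueMin (P : Measure Ω) [IsFiniteMeasure P] (X Y T : Ω → ℝ) : ℝ :=
  mutualInfo P X T - redundancyMin P X Y T

/-! ### The `PM` (pointwise, specificity / ambiguity) decomposition -/

/-- Redundant specificity `E [min (log (1 / p_X(X)), log (1 / p_Y(Y)))]`. -/
def redundantSpecificityPM (P : Measure Ω) (X Y : Ω → ℝ) : ℝ :=
  ∫ ω, min (pointwiseEntropy P X (X ω)) (pointwiseEntropy P Y (Y ω)) ∂P

/-- Redundant ambiguity `E [min (log (1 / p_{X|T}(X|T)), log (1 / p_{Y|T}(Y|T)))]`. -/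
def redundantAmbiguityPM (P : Measure Ω) (X Y T : Ω → ℝ) : ℝ :=
  ∫ ω, min (pointwiseCondEntropy P X T (X ω) (T ω))
    (pointwiseCondEntropy P Y T (Y ω) (T ω)) ∂P

/-- Unique specificity of `X`: `E [log (1 / p_X(X))]` minus the redundant specificity. -/
def uniqueSpecificityPM (P : Measure Ω) (X Y : Ω → ℝ) : ℝ :=
  ∫ ω, pointwiseEntropy P X (X ω) ∂P - redundantSpecificityPM P X Y

/-- Unique ambiguity of `X`: `E [log (1 / p_{X|T}(X|T))]` minus the redundant ambiguity. -/
def uniqueAmbiguityPM (P : Measure Ω) (X Y T : Ω → ℝ) : ℝ :=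
  ∫ ω, pointwiseCondEntropy P X T (X ω) (T ω) ∂P - redundantAmbiguityPM P X Y T

/-- Unique information of `X` in the `PM` decomposition: unique specificity minus unique
ambiguity. -/
def uniquePM (P : Measure Ω) (X Y T : Ω → ℝ) : ℝ :=
  uniqueSpecificityPM P X Y - uniqueAmbiguityPM P X Y T

/-! ### Existence of the quantities above -/

/-- All densities involving the predictor `X` and the target `T` exist, and all expectations that
define the information quantities of `X` about `T` are finite. -/
structure HasFiniteInformation (P : Measure Ω) [IsFiniteMeasure P] (X T : Ω → ℝ) : Prop where
  hasPDF_predictor : HasPDF X P volume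
  hasPDF_target : HasPDF T P volume
  hasPDF_joint : HasPDF (fun ω => (X ω, T ω)) P volume
  integrable_info : Integrable (fun ω => pointwiseInfo P X T (X ω) (T ω)) P
  integrable_info_cond :
    ∀ᵐ ω ∂P, Integrable (fun x => pointwiseInfo P X T x (T ω)) (condDistrib X T P (T ω))
  integrable_specificInfo : Integrable (fun ω => specificInfo P X T (T ω)) P
  integrable_entropy : Integrable (fun ω => pointwiseEntropy P X (X ω)) P
  integrable_condEntropy : Integrable (fun ω => pointwiseCondEntropy P X T (X ω) (T ω)) P

end ContinuousPID

end

/-!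
Write `s(x) = 1 + e^(α - x)`, so that `T = Y / s(X)`, and let `j` be the joint density of `(X, Y)`.
Two planar changes of variables (`hasPDF_comp_and_ae_pdf_comp_eq`) give, almost surely,

* `log p_{X,T}(X, T) = log j(X, Y) + log s(X)`,
* `log p_{Y,T}(Y, T) = log j(X, Y) + 2 log s(X) - log |Y| - (α - X)`.

All terms on the right are integrable. The density of `T` has no closed form, but only the
integrability of `log p_T(T)` is needed, and this follows by comparing likelihood ratios
(`integrable_log_density`). Afterwards `p_T` cancels from every difference between the `X` and the
`Y` quantities.

The divergence comes from the term `α`: knowing `T`, the variable `Y` is nearly determined when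
`α → -∞`, and the pointwise conditional entropies differ by `log s(X) - log |Y| - α + X`, which is
at least `-α` plus a fixed integrable variable. The unique ambiguity is the expected positive part of
this difference, so it tends to `+∞`, while the unique specificity does not depend on `α`.

For the `min` decomposition, the unique information is the expected positive part of
`E[i_X - i_Y | T]`, where `i_X` and `i_Y` are the pointwise informations. Since `log s ≥ 0`,
`i_X - i_Y ≤ W + α` with `W` integrable and independent of the parameter `α`. Jensen's inequality
for the conditional expectation (`uniqueMin_mem_Icc`) bounds the unique information by
`E[(W + α)⁺]`, which tends to `0` by dominated convergence.
-/

namespace ContinuousPID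

/-! ### Densities of random variables -/

section Densities

open scoped ENNReal

variable {Ω E : Type*} [MeasurableSpace Ω] [MeasurableSpace E] {P : Measure Ω}

/-- A density is almost surely positive along its random variable. -/
theorem ae_toReal_pdf_pos [IsFiniteMeasure P] {μ : Measure E} (U : Ω → E) [hU : HasPDF U P μ] :
    ∀ᵐ ω ∂P, 0 < (pdf U P μ (U ω)).toReal := by
  have hpos : ∀ᵐ x ∂(P.map U), 0 < pdf U P μ x := Measure.rnDeriv_pos hU.absolutelyContinuous
  have hfin : ∀ᵐ x ∂(P.map U), pdf U P μ x < ∞ := hU.absolutelyContinuous.ae_le pdf.ae_lt_top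
  filter_upwards [ae_of_ae_map (HasPDF.aemeasurable U P μ) hpos,
    ae_of_ae_map (HasPDF.aemeasurable U P μ) hfin] with ω h₁ h₂
  exact ENNReal.toReal_pos h₁.ne' h₂.ne

/-- The likelihood ratio of an integrable function `q` against the density of `U` has finite
expectation along `U`, namely at most `∫ q`. -/
theorem integrable_toReal_div_pdf {μ : Measure E} (U : Ω → E) [hU : HasPDF U P μ]
    {q : E → ℝ≥0∞} (hq : Measurable q) (hq_int : ∫⁻ x, q x ∂μ ≠ ∞) :
    Integrable (fun ω => (q (U ω) / pdf U P μ (U ω)).toReal) P := by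
  have hm : Measurable fun x => q x / pdf U P μ x := hq.div (measurable_pdf U P μ)
  refine integrable_toReal_of_lintegral_ne_top
    (hm.comp_aemeasurable (HasPDF.aemeasurable U P μ)) (ne_top_of_le_ne_top hq_int ?_)
  rw [← pdf.lintegral_pdf_mul (μ := μ) hm.aemeasurable]
  exact lintegral_mono fun x => ENNReal.mul_div_le

/-- Change of variables for densities: if `Φ` is injective on a set `S` that carries the law of `W`,
with measurable inverse `ψ` and invertible derivative there, then `Φ ∘ W` has a density, whose value
at `Φ (W ω)` is the density of `W` divided by the Jacobian. -/
theorem hasPDF_comp_and_ae_pdf_comp_eq {V : Type*} [NormedAddCommGroup V] [NormedSpace ℝ V]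
    [FiniteDimensional ℝ V] [MeasurableSpace V] [BorelSpace V] {μ : Measure V}
    [μ.IsAddHaarMeasure] [IsFiniteMeasure P] {W : Ω → V} [hW : HasPDF W P μ] {S : Set V}
    (hS : MeasurableSet S) (hWS : ∀ᵐ ω ∂P, W ω ∈ S) {Φ ψ : V → V} {Φ' : V → V →L[ℝ] V}
    (hΦm : Measurable Φ) (hψm : Measurable ψ) (hdetm : Measurable fun z => (Φ' z).det)
    (hΦ : ∀ z ∈ S, HasFDerivAt Φ (Φ' z) z) (hψ : ∀ z ∈ S, ψ (Φ z) = z)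
    (hdet : ∀ z ∈ S, (Φ' z).det ≠ 0) :
    HasPDF (fun ω => Φ (W ω)) P μ ∧
      ∀ᵐ ω ∂P, (pdf (fun ω => Φ (W ω)) P μ (Φ (W ω))).toReal
        = (pdf W P μ (W ω)).toReal / |(Φ' (W ω)).det| := by
  have hWm := HasPDF.aemeasurable W P μ
  have hinj : Set.InjOn Φ S := fun a ha b hb h => by rw [← hψ a ha, h, hψ b hb]
  have hΦ' : ∀ z ∈ S, HasFDerivWithinAt Φ (Φ' z) S z := fun z hz => (hΦ z hz).hasFDerivWithinAt
  have himg : MeasurableSet (Φ '' S) := measurable_image_of_fderivWithin hS hΦ' hinj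
  set r : V → ℝ≥0∞ := fun z => pdf W P μ z / ENNReal.ofReal |(Φ' z).det| with hr
  have hrm : Measurable r :=
    (measurable_pdf W P μ).div hdetm.norm.ennreal_ofReal
  set g : V → ℝ≥0∞ := (Φ '' S).indicator fun w => r (ψ w) with hg
  have hgm : Measurable g := (hrm.comp hψm).indicator himg
  have hmap : P.map (fun ω => Φ (W ω)) = μ.withDensity g := by
    ext A hA
    have hcomp : P.map (fun ω => Φ (W ω)) = (P.map W).map Φ :=
      (AEMeasurable.map_map_of_aemeasurable hΦm.aemeasurable hWm).symm
    have hS' : P.map W Sᶜ = 0 := (ae_map_iff hWm hS).2 hWS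
    calc P.map (fun ω => Φ (W ω)) A = P.map W (Φ ⁻¹' A) := by rw [hcomp, Measure.map_apply hΦm hA]
      _ = P.map W (Φ ⁻¹' A ∩ S) := (measure_inter_conull hS').symm
      _ = ∫⁻ z in Φ ⁻¹' A ∩ S, pdf W P μ z ∂μ :=
        map_eq_setLIntegral_pdf W P μ ((hΦm hA).inter hS)
      _ = ∫⁻ z in S, (Φ ⁻¹' A).indicator (pdf W P μ) z ∂μ := by
        rw [Set.inter_comm, setLIntegral_indicator (hΦm hA), Set.inter_comm]
      _ = ∫⁻ z in S, ENNReal.ofReal |(Φ' z).det| * A.indicator (fun w => r (ψ w)) (Φ z) ∂μ := by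
        refine setLIntegral_congr_fun hS fun z hz => ?_
        by_cases hzA : Φ z ∈ A
        · have h0 : ENNReal.ofReal |(Φ' z).det| ≠ 0 := by
            simpa using hdet z hz
          simp only [Set.indicator, Set.mem_preimage, hzA, if_true, hψ z hz, hr]
          rw [ENNReal.mul_div_cancel h0 ENNReal.ofReal_ne_top]
        · simp [Set.indicator, hzA]
      _ = ∫⁻ w in Φ '' S, A.indicator (fun w => r (ψ w)) w ∂μ :=
        (lintegral_image_eq_lintegral_abs_det_fderiv_mul μ hS hΦ' hinj _).symm
      _ = μ.withDensity g A := by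
        rw [withDensity_apply _ hA, hg, setLIntegral_indicator himg, setLIntegral_indicator hA,
          Set.inter_comm]
  have hpdf : HasPDF (fun ω => Φ (W ω)) P μ :=
    hasPDF_of_map_eq_withDensity (hΦm.comp_aemeasurable hWm) g hgm.aemeasurable hmap
  refine ⟨hpdf, ?_⟩
  have heq := (pdf.eq_of_map_eq_withDensity (X := fun ω => Φ (W ω)) g hgm.aemeasurable).1 hmap
  have heq' := ae_of_ae_map (HasPDF.aemeasurable (fun ω => Φ (W ω)) P μ)
    (hpdf.absolutelyContinuous.ae_le heq)
  filter_upwards [heq', hWS] with ω hω hωS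
  rw [hω, hg, Set.indicator_of_mem (Set.mem_image_of_mem Φ hωS), hψ _ hωS, hr,
    ENNReal.toReal_div, ENNReal.toReal_ofReal (abs_nonneg _)]

end Densities

/-! ### Planar changes of variables -/

/-- The linear map of the plane with matrix `(a, b; c, d)`. -/
noncomputable def planarMap (a b c d : ℝ) : ℝ × ℝ →L[ℝ] ℝ × ℝ :=
  (a • ContinuousLinearMap.fst ℝ ℝ ℝ + b • ContinuousLinearMap.snd ℝ ℝ ℝ).prod
    (c • ContinuousLinearMap.fst ℝ ℝ ℝ + d • ContinuousLinearMap.snd ℝ ℝ ℝ)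

theorem det_planarMap (a b c d : ℝ) : (planarMap a b c d).det = a * d - b * c := by
  have h : planarMap a b c d = (Matrix.toLin (.finTwoProd ℝ) (.finTwoProd ℝ)
      !![a, b; c, d]).toContinuousLinearMap := by
    rw [Matrix.toLin_finTwoProd_toContinuousLinearMap]
    rfl
  rw [h, LinearMap.det_toContinuousLinearMap, LinearMap.det_toLin, Matrix.det_fin_two_of]

variable {Ω : Type*} [MeasurableSpace Ω] {P : Measure Ω}

/-! ### Logarithms of densities and finiteness of information -/

theorem measurable_density (X : Ω → ℝ) : Measurable (density P X) :=
  (measurable_pdf X P volume).ennreal_toReal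

theorem measurable_jointDensity (X T : Ω → ℝ) :
    Measurable fun z : ℝ × ℝ => jointDensity P X T z.1 z.2 :=
  (measurable_pdf (fun ω => (X ω, T ω)) P volume).ennreal_toReal

theorem measurable_pointwiseInfo (X T : Ω → ℝ) :
    Measurable fun z : ℝ × ℝ => pointwiseInfo P X T z.1 z.2 :=
  ((measurable_jointDensity X T).div (((measurable_density X).comp measurable_fst).mul
    ((measurable_density T).comp measurable_snd))).log

theorem integrable_log_gaussianPDFReal [IsProbabilityMeasure P] {U : Ω → ℝ} (hU : MemLp U 2 P)
    (m : ℝ) {v : NNReal} (hv : v ≠ 0) :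
    Integrable (fun ω => Real.log (gaussianPDFReal m v (U ω))) P := by
  have hv' : (0 : ℝ) < v := by positivity
  have h : ∀ x, Real.log (gaussianPDFReal m v x)
      = Real.log (√(2 * Real.pi * v))⁻¹ + -(1 / (2 * v)) * (x - m) ^ 2 := by
    intro x
    rw [gaussianPDFReal, Real.log_mul (by positivity) (Real.exp_pos _).ne', Real.log_exp]
    ring
  simp_rw [h]
  exact (integrable_const _).add (((hU.sub (memLp_const m)).integrable_sq).const_mul _)

/-- The logarithm of the density of `T` along `T` is integrable as soon as `T` has a second moment
and the logarithms of the densities of `X` and `(X, T)` are integrable. Both bounds come from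
`log r ≤ r` for a likelihood ratio `r` of finite expectation: from below, `T` is compared with a
Gaussian density; from above, the joint density of `(X, T)` is compared with the product density. -/
theorem integrable_log_density [IsProbabilityMeasure P] {X T : Ω → ℝ}
    [hX : HasPDF X P volume] [hT : HasPDF T P volume]
    [hXT : HasPDF (fun ω => (X ω, T ω)) P volume] (hT2 : MemLp T 2 P)
    (hlogX : Integrable (fun ω => Real.log (density P X (X ω))) P)
    (hlogXT : Integrable (fun ω => Real.log (jointDensity P X T (X ω) (T ω))) P) :
    Integrable (fun ω => Real.log (density P T (T ω))) P := by
  have hTm := HasPDF.aemeasurable T P volume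
  have hlow := integrable_toReal_div_pdf (P := P) (μ := volume) T
    (measurable_gaussianPDF 0 1) (by rw [lintegral_gaussianPDF_eq_one 0 one_ne_zero]; simp)
  have hup := integrable_toReal_div_pdf (P := P) (μ := volume) (fun ω => (X ω, T ω))
    (q := fun z : ℝ × ℝ => pdf X P volume z.1 * pdf T P volume z.2) (by fun_prop) (by
      rw [Measure.volume_eq_prod, lintegral_prod_mul (by fun_prop) (by fun_prop),
        pdf.lintegral_eq_measure_univ, pdf.lintegral_eq_measure_univ]
      simp)
  have hgauss := integrable_log_gaussianPDFReal hT2 0 one_ne_zero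
  refine Integrable.mono' (((hlow.add hup).add hgauss.norm).add (hlogXT.norm.add hlogX.norm))
    ((measurable_density T).log.comp_aemeasurable hTm).aestronglyMeasurable ?_
  filter_upwards [ae_toReal_pdf_pos (P := P) (μ := volume) X,
    ae_toReal_pdf_pos (P := P) (μ := volume) T,
    ae_toReal_pdf_pos (P := P) (μ := volume) fun ω => (X ω, T ω)] with ω h1 h2 h3
  simp only [Pi.add_apply, ENNReal.toReal_div, ENNReal.toReal_mul, toReal_gaussianPDF,
    Real.norm_eq_abs]
  change 0 < density P X (X ω) at h1
  change 0 < density P T (T ω) at h2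
  change 0 < jointDensity P X T (X ω) (T ω) at h3
  change |Real.log (density P T (T ω))| ≤ gaussianPDFReal 0 1 (T ω) / density P T (T ω) +
    density P X (X ω) * density P T (T ω) / jointDensity P X T (X ω) (T ω) +
    |Real.log (gaussianPDFReal 0 1 (T ω))| +
    (|Real.log (jointDensity P X T (X ω) (T ω))| + |Real.log (density P X (X ω))|)
  have hg := gaussianPDFReal_pos 0 1 (T ω) one_ne_zero
  have e1 := Real.log_le_self (div_pos hg h2).le
  have e2 := Real.log_le_self (div_pos (mul_pos h1 h2) h3).le
  have p1 := div_pos hg h2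
  have p2 := div_pos (mul_pos h1 h2) h3
  rw [Real.log_div hg.ne' h2.ne'] at e1
  rw [Real.log_div (mul_pos h1 h2).ne' h3.ne', Real.log_mul h1.ne' h2.ne'] at e2
  rw [abs_le]
  constructor
  · linarith [neg_abs_le (Real.log (gaussianPDFReal 0 1 (T ω))),
      abs_nonneg (Real.log (jointDensity P X T (X ω) (T ω))),
      abs_nonneg (Real.log (density P X (X ω)))]
  · linarith [abs_nonneg (Real.log (gaussianPDFReal 0 1 (T ω))),
      le_abs_self (Real.log (jointDensity P X T (X ω) (T ω))),
      neg_abs_le (Real.log (density P X (X ω)))]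

theorem ae_pointwiseInfo_eq [IsFiniteMeasure P] (X T : Ω → ℝ)
    [HasPDF X P volume] [HasPDF T P volume] [HasPDF (fun ω => (X ω, T ω)) P volume] :
    ∀ᵐ ω ∂P, pointwiseInfo P X T (X ω) (T ω) = Real.log (jointDensity P X T (X ω) (T ω))
      - Real.log (density P X (X ω)) - Real.log (density P T (T ω)) := by
  filter_upwards [ae_toReal_pdf_pos (P := P) (μ := volume) X,
    ae_toReal_pdf_pos (P := P) (μ := volume) T,
    ae_toReal_pdf_pos (P := P) (μ := volume) fun ω => (X ω, T ω)] with ω h1 h2 h3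
  change 0 < density P X (X ω) at h1
  change 0 < density P T (T ω) at h2
  change 0 < jointDensity P X T (X ω) (T ω) at h3
  rw [pointwiseInfo, Real.log_div h3.ne' (mul_pos h1 h2).ne', Real.log_mul h1.ne' h2.ne']
  ring

theorem ae_pointwiseCondEntropy_eq [IsFiniteMeasure P] (X T : Ω → ℝ)
    [HasPDF T P volume] [HasPDF (fun ω => (X ω, T ω)) P volume] :
    ∀ᵐ ω ∂P, pointwiseCondEntropy P X T (X ω) (T ω)
      = Real.log (density P T (T ω)) - Real.log (jointDensity P X T (X ω) (T ω)) := by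
  filter_upwards [ae_toReal_pdf_pos (P := P) (μ := volume) T,
    ae_toReal_pdf_pos (P := P) (μ := volume) fun ω => (X ω, T ω)] with ω h2 h3
  change 0 < density P T (T ω) at h2
  change 0 < jointDensity P X T (X ω) (T ω) at h3
  rw [pointwiseCondEntropy, condDensity, one_div_div, Real.log_div h2.ne' h3.ne']

theorem integrable_map_pointwiseInfo {X T : Ω → ℝ} (hX : AEMeasurable X P)
    (hT : AEMeasurable T P)
    (h : Integrable (fun ω => pointwiseInfo P X T (X ω) (T ω)) P) :
    Integrable (fun z : ℝ × ℝ => pointwiseInfo P X T z.2 z.1)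
      (P.map fun ω => (T ω, X ω)) :=
  (integrable_map_measure
    ((measurable_pointwiseInfo X T).comp measurable_swap).aestronglyMeasurable
    (hT.prodMk hX)).2 h

/-- Finiteness of all information quantities follows from integrability of the logarithms of the
densities of `X` and `(X, T)`, together with a second moment of `T`. -/
theorem hasFiniteInformation_of_integrable_log [IsProbabilityMeasure P] {X T : Ω → ℝ}
    [hX : HasPDF X P volume] [hT : HasPDF T P volume]
    [hXT : HasPDF (fun ω => (X ω, T ω)) P volume] (hT2 : MemLp T 2 P)
    (hlogX : Integrable (fun ω => Real.log (density P X (X ω))) P)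
    (hlogXT : Integrable (fun ω => Real.log (jointDensity P X T (X ω) (T ω))) P) :
    HasFiniteInformation P X T := by
  have hXm := HasPDF.aemeasurable X P volume
  have hTm := HasPDF.aemeasurable T P volume
  have hlogT := integrable_log_density hT2 hlogX hlogXT
  have hinfo : Integrable (fun ω => pointwiseInfo P X T (X ω) (T ω)) P :=
    ((hlogXT.sub hlogX).sub hlogT).congr <| by
      filter_upwards [ae_pointwiseInfo_eq (P := P) X T] with ω h using h.symm
  have hinfo' := integrable_map_pointwiseInfo hXm hTm hinfo
  refine ⟨hX, hT, hXT, hinfo, hinfo'.condDistrib_ae hTm hXm, hinfo'.integral_condDistrib hTm hXm,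
    ?_, ?_⟩
  · exact hlogX.neg.congr (Eventually.of_forall fun ω => by simp [pointwiseEntropy])
  · exact (hlogT.sub hlogXT).congr <| by
      filter_upwards [ae_pointwiseCondEntropy_eq (P := P) X T] with ω h using h.symm

/-- Specific information is the conditional expectation of the pointwise information. -/
theorem ae_condExp_pointwiseInfo_eq_specificInfo [IsFiniteMeasure P] {X T : Ω → ℝ}
    (hX : AEMeasurable X P) (hT : Measurable T)
    (h : Integrable (fun ω => pointwiseInfo P X T (X ω) (T ω)) P) :
    P[fun ω => pointwiseInfo P X T (X ω) (T ω) | MeasurableSpace.comap T inferInstance]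
      =ᵐ[P] fun ω => specificInfo P X T (T ω) :=
  condExp_prod_ae_eq_integral_condDistrib' (f := fun z : ℝ × ℝ => pointwiseInfo P X T z.2 z.1)
    hT hX (integrable_map_pointwiseInfo hX hT.aemeasurable h)

/-! ### Bounds on the unique information -/

/-- The unique information of the `min` decomposition is the expected positive part of
`I_X(T) - I_Y(T) = E[i_X - i_Y | T]`. By Jensen's inequality it is at most the expected positive
part of any integrable upper bound for the pointwise difference `i_X - i_Y`. -/
theorem uniqueMin_mem_Icc [IsProbabilityMeasure P] {X Y T : Ω → ℝ} (hT : Measurable T)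
    (hX : HasFiniteInformation P X T) (hY : HasFiniteInformation P Y T) {W : Ω → ℝ}
    (hW : Integrable W P)
    (hle : ∀ᵐ ω ∂P, pointwiseInfo P X T (X ω) (T ω) - pointwiseInfo P Y T (Y ω) (T ω) ≤ W ω) :
    uniqueMin P X Y T ∈ Set.Icc 0 (∫ ω, max (W ω) 0 ∂P) := by
  have hXm := hX.hasPDF_predictor.aemeasurable
  have hYm := hY.hasPDF_predictor.aemeasurable
  have cX := ae_condExp_pointwiseInfo_eq_specificInfo hXm hT hX.integrable_info
  have cY := ae_condExp_pointwiseInfo_eq_specificInfo hYm hT hY.integrable_info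
  have hmut : mutualInfo P X T = ∫ ω, specificInfo P X T (T ω) ∂P := by
    rw [mutualInfo, ← integral_condExp hT.comap_le]
    exact integral_congr_ae cX
  have hmin : Integrable
      (fun ω => min (specificInfo P X T (T ω)) (specificInfo P Y T (T ω))) P :=
    hX.integrable_specificInfo.inf hY.integrable_specificInfo
  have heq : uniqueMin P X Y T = ∫ ω, (specificInfo P X T (T ω)
      - min (specificInfo P X T (T ω)) (specificInfo P Y T (T ω))) ∂P := by
    rw [uniqueMin, redundancyMin, hmut, integral_sub hX.integrable_specificInfo hmin]
  have hWp : Integrable (fun ω => max (W ω) 0) P := hW.pos_part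
  rw [heq]
  refine ⟨integral_nonneg fun ω => sub_nonneg.2 (min_le_left _ _), ?_⟩
  rw [← integral_condExp hT.comap_le (f := fun ω => max (W ω) 0)]
  refine integral_mono_ae (hX.integrable_specificInfo.sub hmin) integrable_condExp ?_
  have hsub := condExp_sub hX.integrable_info hY.integrable_info
    (MeasurableSpace.comap T inferInstance)
  have hmono : P[(fun ω => pointwiseInfo P X T (X ω) (T ω)) -
      (fun ω => pointwiseInfo P Y T (Y ω) (T ω)) | MeasurableSpace.comap T inferInstance]
      ≤ᵐ[P] P[fun ω => max (W ω) 0 | MeasurableSpace.comap T inferInstance] :=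
    condExp_mono (hX.integrable_info.sub hY.integrable_info) hWp <| by
      filter_upwards [hle] with ω h using h.trans (le_max_left _ _)
  have hnonneg : 0 ≤ᵐ[P] P[fun ω => max (W ω) 0 | MeasurableSpace.comap T inferInstance] :=
    condExp_nonneg (Eventually.of_forall fun ω => le_max_right _ _)
  filter_upwards [cX, cY, hsub, hmono, hnonneg] with ω h1 h2 h3 h4 h5
  rw [h3, Pi.sub_apply, h1, h2] at h4
  rcases min_choice (specificInfo P X T (T ω)) (specificInfo P Y T (T ω)) with h | h
  · rw [h, sub_self]
    exact h5
  · rw [h]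
    exact h4

/-- The unique ambiguity is the expected positive part of the difference of the pointwise
conditional entropies, hence at least the expected difference. -/
theorem integral_sub_le_uniqueAmbiguityPM {X Y T : Ω → ℝ} [IsFiniteMeasure P]
    (hX : HasFiniteInformation P X T) (hY : HasFiniteInformation P Y T) :
    ∫ ω, (pointwiseCondEntropy P X T (X ω) (T ω) - pointwiseCondEntropy P Y T (Y ω) (T ω)) ∂P
      ≤ uniqueAmbiguityPM P X Y T := by
  rw [integral_sub hX.integrable_condEntropy hY.integrable_condEntropy, uniqueAmbiguityPM,
    redundantAmbiguityPM]
  exact sub_le_sub_left (integral_mono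
    (hX.integrable_condEntropy.inf hY.integrable_condEntropy) hY.integrable_condEntropy
    fun ω => min_le_right _ _) _

/-! ### Gaussian pairs -/

theorem hasPDF_and_ae_density_eq_of_map_eq_gaussianReal [IsFiniteMeasure P] {U : Ω → ℝ}
    (hU : AEMeasurable U P) {m : ℝ} {v : NNReal} (hv : v ≠ 0) (h : P.map U = gaussianReal m v) :
    HasPDF U P volume ∧ ∀ᵐ ω ∂P, density P U (U ω) = gaussianPDFReal m v (U ω) := by
  rw [gaussianReal_of_var_ne_zero m hv] at h
  have hm : AEMeasurable (gaussianPDF m v) volume := (measurable_gaussianPDF m v).aemeasurable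
  have hpdf : HasPDF U P volume := hasPDF_of_map_eq_withDensity hU _ hm h
  have heq := hpdf.absolutelyContinuous.ae_le ((pdf.eq_of_map_eq_withDensity _ hm).1 h)
  refine ⟨hpdf, ?_⟩
  filter_upwards [ae_of_ae_map hU heq] with ω hω
  rw [density, hω, toReal_gaussianPDF]

/-- The logarithm is integrable for the standard normal law: near zero because it is locally
integrable and the Gaussian density is bounded, away from zero because it grows at most linearly. -/
theorem integrable_log_gaussianReal : Integrable Real.log (gaussianReal 0 1) := by
  have hlin : Integrable (fun x : ℝ => x) (gaussianReal 0 1) :=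
    memLp_one_iff_integrable.1 (memLp_id_gaussianReal (μ := 0) (v := 1) 1)
  rw [gaussianReal_of_var_ne_zero 0 one_ne_zero] at hlin ⊢
  have hfin : ∀ᵐ x ∂(volume : Measure ℝ), gaussianPDF 0 1 x < ⊤ :=
    Eventually.of_forall fun _ => gaussianPDF_lt_top
  rw [integrable_withDensity_iff (measurable_gaussianPDF 0 1) hfin] at hlin ⊢
  simp only [toReal_gaussianPDF] at hlin ⊢
  have hlog : IntegrableOn Real.log (Set.Ioc (-1) 1) volume :=
    (intervalIntegrable_iff_integrableOn_Ioc_of_le (by norm_num)).1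
      intervalIntegral.intervalIntegrable_log'
  set c : ℝ := (√(2 * Real.pi * (1 : NNReal)))⁻¹ with hc
  have hc0 : 0 ≤ c := by positivity
  have hbound : ∀ x, gaussianPDFReal 0 1 x ≤ c := fun x => by
    rw [gaussianPDFReal]
    refine mul_le_of_le_one_right hc0 (Real.exp_le_one_iff.2 ?_)
    exact div_nonpos_of_nonpos_of_nonneg (neg_nonpos.2 (sq_nonneg _)) (by positivity)
  have hnear := (IntegrableOn.integrable_indicator hlog.norm measurableSet_Ioc).mul_const c
  refine Integrable.mono' (hnear.add hlin.norm) (Real.measurable_log.mul (measurable_gaussianPDFReal 0 1)).aestronglyMeasurable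
    (Eventually.of_forall fun x => ?_)
  have hφ := gaussianPDFReal_nonneg 0 1 x
  simp only [norm_mul, Real.norm_eq_abs, Pi.add_apply, abs_of_nonneg hφ]
  by_cases hx : x ∈ Set.Ioc (-1 : ℝ) 1
  · rw [Set.indicator_of_mem hx]
    nlinarith [mul_le_mul_of_nonneg_left (hbound x) (abs_nonneg (Real.log x)),
      mul_nonneg (abs_nonneg x) hφ]
  · rw [Set.indicator_of_notMem hx, zero_mul, zero_add]
    refine mul_le_mul_of_nonneg_right ?_ hφ
    have hx1 : 1 ≤ |x| := by
      by_contra! h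
      exact hx ⟨(abs_lt.1 h).1, (abs_lt.1 h).2.le⟩
    rw [← Real.log_abs, abs_of_nonneg (Real.log_nonneg hx1)]
    exact Real.log_le_self (abs_nonneg x)

namespace IsNormalizedGaussianPair

variable {ρ : ℝ} {X Y : Ω → ℝ}

theorem symm (h : IsNormalizedGaussianPair P ρ X Y) : IsNormalizedGaussianPair P ρ Y X where
  gaussian := h.gaussian.map_equiv (ContinuousLinearEquiv.prodComm ℝ ℝ ℝ)
  mean_left := h.mean_right
  mean_right := h.mean_left
  variance_left := h.variance_right
  variance_right := h.variance_left
  covariance_eq := by rw [covariance_comm, h.covariance_eq]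

theorem map_left_eq (h : IsNormalizedGaussianPair P ρ X Y) : P.map X = gaussianReal 0 1 := by
  rw [h.gaussian.fst.map_eq_gaussianReal, h.mean_left, h.variance_left, Real.toNNReal_one]

theorem integrable_log_right (h : IsNormalizedGaussianPair P ρ X Y) :
    Integrable (fun ω => Real.log (Y ω)) P :=
  (integrable_map_measure Real.measurable_log.aestronglyMeasurable
    h.gaussian.snd.aemeasurable).1 (by rw [h.symm.map_left_eq]; exact integrable_log_gaussianReal)

theorem ae_right_ne_zero (h : IsNormalizedGaussianPair P ρ X Y) : ∀ᵐ ω ∂P, Y ω ≠ 0 := by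
  refine ae_of_ae_map (p := fun y : ℝ => y ≠ 0) h.gaussian.snd.aemeasurable ?_
  rw [h.symm.map_left_eq]
  exact (gaussianReal_absolutelyContinuous 0 one_ne_zero).ae_le (Measure.ae_ne volume 0)

theorem hasPDF_left [IsProbabilityMeasure P] (h : IsNormalizedGaussianPair P ρ X Y) :
    HasPDF X P volume :=
  (hasPDF_and_ae_density_eq_of_map_eq_gaussianReal h.gaussian.fst.aemeasurable one_ne_zero
    h.map_left_eq).1

theorem integrable_log_density_left [IsProbabilityMeasure P]
    (h : IsNormalizedGaussianPair P ρ X Y) :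
    Integrable (fun ω => Real.log (density P X (X ω))) P := by
  have hX := h.gaussian.fst
  refine (integrable_log_gaussianPDFReal hX.memLp_two 0 one_ne_zero).congr ?_
  filter_upwards [(hasPDF_and_ae_density_eq_of_map_eq_gaussianReal hX.aemeasurable one_ne_zero
    h.map_left_eq).2] with ω hω
  rw [hω]

/-- A nondegenerate Gaussian pair has a joint density whose logarithm is integrable along the pair:
the pair is the image of the independent pair `(X, Y - ρ X)` under a shear. -/
theorem hasPDF_and_integrable_log_jointDensity [IsProbabilityMeasure P]
    (hρ : ρ ∈ Set.Ioo (-1 : ℝ) 1) (h : IsNormalizedGaussianPair P ρ X Y) :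
    HasPDF (fun ω => (X ω, Y ω)) P volume ∧
      Integrable (fun ω => Real.log (jointDensity P X Y (X ω) (Y ω))) P := by
  have hX := h.gaussian.fst
  have hY := h.gaussian.snd
  set Z : Ω → ℝ := fun ω => Y ω - ρ * X ω with hZdef
  have hXZ : HasGaussianLaw (fun ω => (X ω, Z ω)) P := by
    have := h.gaussian.map_fun (planarMap 1 0 (-ρ) 1)
    simpa [planarMap, hZdef, sub_eq_neg_add] using this
  have hZ := hXZ.snd
  have hρX : MemLp (fun ω => ρ * X ω) 2 P := hX.memLp_two.const_mul ρ
  have hcov : covariance X Z P = 0 := by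
    have : Z = Y - fun ω => ρ * X ω := rfl
    rw [this, covariance_sub_right hX.memLp_two hY.memLp_two hρX, h.covariance_eq,
      covariance_const_mul_right, covariance_self hX.aemeasurable, h.variance_left]
    ring
  have hvar : variance Z P = 1 - ρ ^ 2 := by
    have : Z = Y - fun ω => ρ * X ω := rfl
    rw [this, variance_sub hY.memLp_two hρX, h.variance_right, variance_const_mul,
      covariance_const_mul_right, covariance_comm, h.covariance_eq, h.variance_left]
    ring
  have hmean : ∫ ω, Z ω ∂P = 0 := by
    rw [hZdef, integral_sub hY.integrable (hX.integrable.const_mul ρ), integral_const_mul,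
      h.mean_left, h.mean_right]
    ring
  set v : NNReal := (1 - ρ ^ 2).toNNReal with hvdef
  have hv : v ≠ 0 := by
    have : 0 < 1 - ρ ^ 2 := by nlinarith [hρ.1, hρ.2]
    exact (Real.toNNReal_pos.2 this).ne'
  have hZmap : P.map Z = gaussianReal 0 v := by
    rw [hZ.map_eq_gaussianReal, hmean, hvar]
  have hind : IndepFun X Z P := hXZ.indepFun_of_covariance_eq_zero hcov
  set g : ℝ × ℝ → ENNReal := fun z => gaussianPDF 0 1 z.1 * gaussianPDF 0 v z.2 with hg
  have hgm : AEMeasurable g volume :=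
    (((measurable_gaussianPDF 0 1).comp measurable_fst).mul
      ((measurable_gaussianPDF 0 v).comp measurable_snd)).aemeasurable
  have hmap : P.map (fun ω => (X ω, Z ω)) = volume.withDensity g := by
    rw [(indepFun_iff_map_prod_eq_prod_map_map hX.aemeasurable hZ.aemeasurable).1 hind,
      h.map_left_eq, hZmap, gaussianReal_of_var_ne_zero 0 one_ne_zero,
      gaussianReal_of_var_ne_zero 0 hv,
      prod_withDensity (measurable_gaussianPDF 0 1) (measurable_gaussianPDF 0 v),
      Measure.volume_eq_prod]
  have hpdf : HasPDF (fun ω => (X ω, Z ω)) P volume :=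
    hasPDF_of_map_eq_withDensity hXZ.aemeasurable g hgm hmap
  have heq := ae_of_ae_map hXZ.aemeasurable
    (hpdf.absolutelyContinuous.ae_le ((pdf.eq_of_map_eq_withDensity g hgm).1 hmap))
  obtain ⟨h1, h2⟩ := hasPDF_comp_and_ae_pdf_comp_eq (P := P) (μ := (volume : Measure (ℝ × ℝ)))
    (W := fun ω => (X ω, Z ω)) (S := Set.univ) (Φ := planarMap 1 0 ρ 1)
    (ψ := planarMap 1 0 (-ρ) 1) (Φ' := fun _ => planarMap 1 0 ρ 1)
    MeasurableSet.univ (by simp) (by fun_prop) (by fun_prop) measurable_const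
    (fun z _ => ContinuousLinearMap.hasFDerivAt _)
    (fun z _ => by ext <;> simp [planarMap]) (by simp [det_planarMap])
  have hfun : (fun ω => planarMap 1 0 ρ 1 (X ω, Z ω)) = fun ω => (X ω, Y ω) := by
    funext ω
    simp [planarMap, hZdef]
  rw [hfun] at h1 h2
  refine ⟨h1, ((integrable_log_gaussianPDFReal hX.memLp_two 0 one_ne_zero).add
    (integrable_log_gaussianPDFReal hZ.memLp_two 0 hv)).congr ?_⟩
  filter_upwards [heq, h2] with ω e1 e2
  have e3 : planarMap 1 0 ρ 1 (X ω, Z ω) = (X ω, Y ω) := congrFun hfun ω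
  rw [e1, e3, det_planarMap] at e2
  rw [jointDensity, e2, hg, ENNReal.toReal_mul, toReal_gaussianPDF, toReal_gaussianPDF, Pi.add_apply,
    ← Real.log_mul (gaussianPDFReal_pos 0 1 _ one_ne_zero).ne' (gaussianPDFReal_pos 0 v _ hv).ne']
  simp

end IsNormalizedGaussianPair

/-! ### The sigmoidal switch -/

/-- The denominator `s_α(x) = 1 + e^(α - x)` of the sigmoidal switch. -/
noncomputable def switchDenom (α x : ℝ) : ℝ := 1 + Real.exp (α - x)

theorem one_lt_switchDenom (α x : ℝ) : 1 < switchDenom α x :=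
  lt_add_of_pos_right 1 (Real.exp_pos _)

theorem switchDenom_pos (α x : ℝ) : 0 < switchDenom α x :=
  zero_lt_one.trans (one_lt_switchDenom α x)

theorem measurable_switchDenom (α : ℝ) : Measurable (switchDenom α) := by
  unfold switchDenom
  fun_prop

theorem log_switchDenom_nonneg (α x : ℝ) : 0 ≤ Real.log (switchDenom α x) :=
  Real.log_nonneg (one_lt_switchDenom α x).le

theorem log_switchDenom_le (α x : ℝ) : Real.log (switchDenom α x) ≤ Real.log 2 + |α - x| := by
  rw [← Real.log_exp |α - x|, ← Real.log_mul two_ne_zero (Real.exp_pos _).ne']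
  refine Real.log_le_log (switchDenom_pos α x) ?_
  have h1 : Real.exp (α - x) ≤ Real.exp |α - x| := Real.exp_le_exp.2 (le_abs_self _)
  have h2 : 1 ≤ Real.exp |α - x| := Real.one_le_exp (abs_nonneg _)
  rw [switchDenom]
  linarith

theorem abs_sigmoidalSwitch_le (α x y : ℝ) : |sigmoidalSwitch α x y| ≤ |y| := by
  change |y / switchDenom α x| ≤ |y|
  rw [abs_div, abs_of_pos (switchDenom_pos α x)]
  exact div_le_self (abs_nonneg y) (one_lt_switchDenom α x).le

theorem integrable_log_switchDenom [IsFiniteMeasure P] {X : Ω → ℝ} (hX : Integrable X P) (α : ℝ) :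
    Integrable (fun ω => Real.log (switchDenom α (X ω))) P := by
  refine Integrable.mono' ((integrable_const (Real.log 2)).add
    ((integrable_const α).sub hX).abs)
    ((measurable_switchDenom α).log.comp_aemeasurable hX.aemeasurable).aestronglyMeasurable
    (Eventually.of_forall fun ω => ?_)
  rw [Real.norm_eq_abs, abs_of_nonneg (log_switchDenom_nonneg α _)]
  exact log_switchDenom_le α (X ω)

theorem hasFDerivAt_sigmoidalSwitch (α : ℝ) (z : ℝ × ℝ) :
    HasFDerivAt (fun z : ℝ × ℝ => sigmoidalSwitch α z.1 z.2)
      ((z.2 * Real.exp (α - z.1) / switchDenom α z.1 ^ 2) • ContinuousLinearMap.fst ℝ ℝ ℝ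
        + (1 / switchDenom α z.1) • ContinuousLinearMap.snd ℝ ℝ ℝ) z := by
  have hs := (switchDenom_pos α z.1).ne'
  have h1 : HasDerivAt (switchDenom α) (Real.exp (α - z.1) * (-1)) z.1 :=
    (((hasDerivAt_id z.1).const_sub α).exp).const_add 1
  have h2 : HasDerivAt (fun x => (switchDenom α x)⁻¹) _ z.1 := h1.inv hs
  have h3 := (hasFDerivAt_snd (𝕜 := ℝ) (p := z)).mul (h2.comp_hasFDerivAt z hasFDerivAt_fst)
  refine h3.congr_fderiv ?_
  ext
  · simp
    field_simp
  · simp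

/-- Density of `(X, T)` along `(X, T)`: the change of variables `(x, y) ↦ (x, y / s(x))` has
Jacobian `1 / s(x)`. -/
theorem hasPDF_and_ae_jointDensity_left_eq [IsFiniteMeasure P] {α : ℝ} {X Y T : Ω → ℝ}
    (hT : IsNoiseFreeInteraction (sigmoidalSwitch α) X Y T)
    [hXY : HasPDF (fun ω => (X ω, Y ω)) P volume] :
    HasPDF (fun ω => (X ω, T ω)) P volume ∧ ∀ᵐ ω ∂P, jointDensity P X T (X ω) (T ω)
      = jointDensity P X Y (X ω) (Y ω) * switchDenom α (X ω) := by
  have hcont := (continuous_sigmoidalSwitch α).measurable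
  have hsm : Measurable fun z : ℝ × ℝ => switchDenom α z.1 :=
    (measurable_switchDenom α).comp measurable_fst
  obtain ⟨h1, h2⟩ := hasPDF_comp_and_ae_pdf_comp_eq (P := P) (μ := (volume : Measure (ℝ × ℝ)))
    (W := fun ω => (X ω, Y ω)) (S := Set.univ)
    (Φ := fun z => (z.1, sigmoidalSwitch α z.1 z.2))
    (ψ := fun z => (z.1, z.2 * switchDenom α z.1))
    (Φ' := fun z => planarMap 1 0 (z.2 * Real.exp (α - z.1) / switchDenom α z.1 ^ 2)
      (1 / switchDenom α z.1))
    MeasurableSet.univ (by simp) (measurable_fst.prodMk hcont)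
    (measurable_fst.prodMk (measurable_snd.mul hsm))
    (by
      simp only [det_planarMap, one_mul, zero_mul, sub_zero]
      exact hsm.const_div 1)
    (fun z _ => by
      refine (hasFDerivAt_fst.prodMk (hasFDerivAt_sigmoidalSwitch α z)).congr_fderiv ?_
      simp [planarMap])
    (fun z _ => Prod.ext rfl (div_mul_cancel₀ z.2 (switchDenom_pos α z.1).ne'))
    (fun z _ => by simpa [det_planarMap] using (switchDenom_pos α z.1).ne')
  simp only [← hT.target_eq] at h1 h2
  refine ⟨h1, ?_⟩
  filter_upwards [h2] with ω hω
  rw [jointDensity, hω, det_planarMap, jointDensity, one_mul, zero_mul, sub_zero,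
    abs_of_pos (one_div_pos.2 (switchDenom_pos α _)), div_div_eq_mul_div, div_one]

/-- Density of `(Y, T)` along `(Y, T)`: away from `y = 0` the change of variables
`(x, y) ↦ (y, y / s(x))` has Jacobian `|y| e^(α - x) / s(x)²`. -/
theorem hasPDF_and_ae_jointDensity_right_eq [IsFiniteMeasure P] {α : ℝ} {X Y T : Ω → ℝ}
    (hT : IsNoiseFreeInteraction (sigmoidalSwitch α) X Y T)
    [hXY : HasPDF (fun ω => (X ω, Y ω)) P volume] (hY0 : ∀ᵐ ω ∂P, Y ω ≠ 0) :
    HasPDF (fun ω => (Y ω, T ω)) P volume ∧ ∀ᵐ ω ∂P, jointDensity P Y T (Y ω) (T ω)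
      = jointDensity P X Y (X ω) (Y ω)
        / (|Y ω| * Real.exp (α - X ω) / switchDenom α (X ω) ^ 2) := by
  have hcont := (continuous_sigmoidalSwitch α).measurable
  have hsm : Measurable fun z : ℝ × ℝ => switchDenom α z.1 :=
    (measurable_switchDenom α).comp measurable_fst
  obtain ⟨h1, h2⟩ := hasPDF_comp_and_ae_pdf_comp_eq (P := P) (μ := (volume : Measure (ℝ × ℝ)))
    (W := fun ω => (X ω, Y ω)) (S := {z | z.2 ≠ 0})
    (Φ := fun z => (z.2, sigmoidalSwitch α z.1 z.2))
    (ψ := fun z => (α - Real.log (z.1 / z.2 - 1), z.1))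
    (Φ' := fun z => planarMap 0 1 (z.2 * Real.exp (α - z.1) / switchDenom α z.1 ^ 2)
      (1 / switchDenom α z.1))
    (measurableSet_eq_fun measurable_snd measurable_const).compl hY0 (measurable_snd.prodMk hcont)
    (by fun_prop)
    (by
      simp only [det_planarMap, zero_mul, one_mul, zero_sub]
      exact (Measurable.div (by fun_prop) (hsm.pow_const 2)).neg)
    (fun z _ => by
      refine (hasFDerivAt_snd.prodMk (hasFDerivAt_sigmoidalSwitch α z)).congr_fderiv ?_
      simp [planarMap])
    (fun z hz => by
      -- On this set `y / t - 1 = e^(α - x)`, which determines `x`.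
      refine Prod.ext ?_ rfl
      change α - Real.log (z.2 / (z.2 / (1 + Real.exp (α - z.1))) - 1) = z.1
      rw [div_div_cancel₀ hz, add_sub_cancel_left, Real.log_exp, sub_sub_cancel])
    (fun z hz => by
      simp only [det_planarMap, zero_mul, one_mul, zero_sub]
      exact neg_ne_zero.2 (div_ne_zero (mul_ne_zero hz (Real.exp_pos _).ne')
        (pow_ne_zero 2 (switchDenom_pos α z.1).ne')))
  simp only [← hT.target_eq] at h1 h2
  refine ⟨h1, ?_⟩
  filter_upwards [h2] with ω hω
  rw [jointDensity, hω, det_planarMap, jointDensity, zero_mul, one_mul, zero_sub, abs_neg, abs_div,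
    abs_mul, abs_of_pos (Real.exp_pos _), abs_of_pos (pow_pos (switchDenom_pos α _) 2)]

/-- Logarithms of the densities of `(X, T)` and `(Y, T)` in terms of that of `(X, Y)`. The term
`Real.log (Y ω)` stands for `log |Y ω|`, by the convention for negative arguments. -/
theorem ae_log_jointDensity_eq [IsFiniteMeasure P] {α : ℝ} {X Y T : Ω → ℝ}
    (hT : IsNoiseFreeInteraction (sigmoidalSwitch α) X Y T)
    [hXY : HasPDF (fun ω => (X ω, Y ω)) P volume] (hY0 : ∀ᵐ ω ∂P, Y ω ≠ 0) :
    ∀ᵐ ω ∂P,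
      Real.log (jointDensity P X T (X ω) (T ω)) = Real.log (jointDensity P X Y (X ω) (Y ω))
        + Real.log (switchDenom α (X ω)) ∧
      Real.log (jointDensity P Y T (Y ω) (T ω)) = Real.log (jointDensity P X Y (X ω) (Y ω))
        + 2 * Real.log (switchDenom α (X ω)) - Real.log (Y ω) - (α - X ω) := by
  filter_upwards [(hasPDF_and_ae_jointDensity_left_eq hT).2,
    (hasPDF_and_ae_jointDensity_right_eq hT hY0).2, hY0,
    ae_toReal_pdf_pos (P := P) (μ := volume) fun ω => (X ω, Y ω)] with ω h1 h2 h3 h4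
  change 0 < jointDensity P X Y (X ω) (Y ω) at h4
  have hs := (switchDenom_pos α (X ω)).ne'
  have hy : |Y ω| ≠ 0 := abs_ne_zero.2 h3
  have he := (Real.exp_pos (α - X ω)).ne'
  refine ⟨by rw [h1, Real.log_mul h4.ne' hs], ?_⟩
  rw [h2, Real.log_div h4.ne' (div_ne_zero (mul_ne_zero hy he) (pow_ne_zero 2 hs)),
    Real.log_div (mul_ne_zero hy he) (pow_ne_zero 2 hs), Real.log_mul hy he, Real.log_abs,
    Real.log_exp, Real.log_pow]
  push_cast
  ring

theorem hasPDF_snd_of_hasPDF_prod [IsFiniteMeasure P] {X T : Ω → ℝ}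
    [HasPDF (fun ω => (X ω, T ω)) P volume] : HasPDF T P volume :=
  pdf.quasiMeasurePreserving_hasPDF' (fun ω => (X ω, T ω))
    (Measure.quasiMeasurePreserving_snd (μ := (volume : Measure ℝ)) (ν := (volume : Measure ℝ)))

theorem hasFiniteInformation_sigmoidalSwitch [IsProbabilityMeasure P] {ρ : ℝ}
    (hρ : ρ ∈ Set.Ioo (-1 : ℝ) 1) {α : ℝ} {X Y T : Ω → ℝ} (h : IsNormalizedGaussianPair P ρ X Y)
    (hT : IsNoiseFreeInteraction (sigmoidalSwitch α) X Y T) :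
    HasFiniteInformation P X T ∧ HasFiniteInformation P Y T := by
  have hX := h.gaussian.fst
  have hY := h.gaussian.snd
  have := h.hasPDF_left
  have := h.symm.hasPDF_left
  obtain ⟨_, hlog⟩ := h.hasPDF_and_integrable_log_jointDensity hρ
  have := (hasPDF_and_ae_jointDensity_left_eq (P := P) hT).1
  have := (hasPDF_and_ae_jointDensity_right_eq hT h.ae_right_ne_zero).1
  have : HasPDF T P volume := hasPDF_snd_of_hasPDF_prod (X := X)
  have hs := integrable_log_switchDenom hX.integrable α
  have hT2 : MemLp T 2 P :=
    hY.memLp_two.mono (HasPDF.aemeasurable T P volume).aestronglyMeasurable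
      (Eventually.of_forall fun ω => by
        rw [hT.target_eq]
        exact abs_sigmoidalSwitch_le α (X ω) (Y ω))
  have hae := ae_log_jointDensity_eq hT h.ae_right_ne_zero
  refine ⟨hasFiniteInformation_of_integrable_log hT2 h.integrable_log_density_left ?_,
    hasFiniteInformation_of_integrable_log hT2 h.symm.integrable_log_density_left ?_⟩
  · exact (hlog.add hs).congr (by filter_upwards [hae] with ω hω using hω.1.symm)
  · exact (((hlog.add (hs.const_mul 2)).sub h.integrable_log_right).sub
      ((integrable_const α).sub hX.integrable)).congr
      (by filter_upwards [hae] with ω hω using hω.2.symm)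

/-! ### The limit `α → -∞` -/

theorem tendsto_integral_max_add_atBot {W : Ω → ℝ} (hW : Integrable W P) :
    Tendsto (fun α : ℝ => ∫ ω, max (W ω + α) 0 ∂P) atBot (𝓝 0) := by
  suffices h : Tendsto (fun α : ℝ => ∫ ω, max (W ω + α) 0 ∂P) atBot (𝓝 (∫ _ : Ω, (0 : ℝ) ∂P)) by
    simpa using h
  refine tendsto_integral_filter_of_dominated_convergence (fun ω => |W ω|) ?_ ?_ hW.abs ?_
  · exact Eventually.of_forall fun α =>
      ((hW.aemeasurable.add_const α).max aemeasurable_const).aestronglyMeasurable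
  · filter_upwards [eventually_le_atBot 0] with α hα
    refine Eventually.of_forall fun ω => ?_
    rw [Real.norm_eq_abs, abs_of_nonneg (le_max_right _ _)]
    exact max_le (by linarith [le_abs_self (W ω)]) (abs_nonneg _)
  · refine Eventually.of_forall fun ω => tendsto_const_nhds.congr' ?_
    filter_upwards [eventually_le_atBot (-W ω)] with α hα
    rw [max_eq_right (by linarith)]

theorem tendsto_uniqueMin_sigmoidalSwitch [IsProbabilityMeasure P] {ρ : ℝ}
    (hρ : ρ ∈ Set.Ioo (-1 : ℝ) 1) {X Y : Ω → ℝ} {T : ℝ → Ω → ℝ}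
    (h : IsNormalizedGaussianPair P ρ X Y)
    (hT : ∀ α, IsNoiseFreeInteraction (sigmoidalSwitch α) X Y (T α)) :
    Tendsto (fun α => uniqueMin P X Y (T α)) atBot (𝓝 0) := by
  have hX := h.gaussian.fst
  have hfin α := hasFiniteInformation_sigmoidalSwitch hρ h (hT α)
  obtain ⟨_, -⟩ := h.hasPDF_and_integrable_log_jointDensity hρ
  set W : Ω → ℝ := fun ω => Real.log (Y ω) - X ω - Real.log (density P X (X ω))
    + Real.log (density P Y (Y ω)) with hWdef
  have hW : Integrable W P := ((h.integrable_log_right.sub hX.integrable).sub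
    h.integrable_log_density_left).add h.symm.integrable_log_density_left
  have hmem (α : ℝ) : uniqueMin P X Y (T α) ∈ Set.Icc 0 (∫ ω, max (W ω + α) 0 ∂P) := by
    obtain ⟨hfX, hfY⟩ := hfin α
    have := hfX.hasPDF_predictor
    have := hfY.hasPDF_predictor
    have := hfX.hasPDF_target
    have := hfX.hasPDF_joint
    have := hfY.hasPDF_joint
    have hTm : Measurable (T α) := by
      have : T α = fun ω => sigmoidalSwitch α (X ω) (Y ω) := funext (hT α).target_eq
      rw [this]
      exact (continuous_sigmoidalSwitch α).measurable.comp
        ((hT α).measurable_left.prodMk (hT α).measurable_right)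
    refine uniqueMin_mem_Icc hTm hfX hfY (hW.add (integrable_const α)) ?_
    -- The difference is `W + α - log s(X)`, and `log s ≥ 0`.
    filter_upwards [ae_pointwiseInfo_eq (P := P) X (T α), ae_pointwiseInfo_eq (P := P) Y (T α),
      ae_log_jointDensity_eq (hT α) h.ae_right_ne_zero] with ω h1 h2 h3
    rw [h1, h2, h3.1, h3.2]
    simp only [hWdef]
    linarith [log_switchDenom_nonneg α (X ω)]
  exact tendsto_of_tendsto_of_tendsto_of_le_of_le tendsto_const_nhds
    (tendsto_integral_max_add_atBot hW) (fun α => (hmem α).1) fun α => (hmem α).2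

theorem tendsto_uniqueAmbiguityPM_sigmoidalSwitch [IsProbabilityMeasure P] {ρ : ℝ}
    (hρ : ρ ∈ Set.Ioo (-1 : ℝ) 1) {X Y : Ω → ℝ} {T : ℝ → Ω → ℝ}
    (h : IsNormalizedGaussianPair P ρ X Y)
    (hT : ∀ α, IsNoiseFreeInteraction (sigmoidalSwitch α) X Y (T α)) :
    Tendsto (fun α => uniqueAmbiguityPM P X Y (T α)) atBot atTop := by
  have hX := h.gaussian.fst
  obtain ⟨_, -⟩ := h.hasPDF_and_integrable_log_jointDensity hρ
  have hlow (α : ℝ) : -α + ∫ ω, (X ω - Real.log (Y ω)) ∂P ≤ uniqueAmbiguityPM P X Y (T α) := by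
    obtain ⟨hfX, hfY⟩ := hasFiniteInformation_sigmoidalSwitch hρ h (hT α)
    have := hfX.hasPDF_target
    have := hfX.hasPDF_joint
    have := hfY.hasPDF_joint
    refine le_trans ?_ (integral_sub_le_uniqueAmbiguityPM hfX hfY)
    have hint : Integrable (fun ω => X ω - Real.log (Y ω)) P :=
      hX.integrable.sub h.integrable_log_right
    have hconst : -α = ∫ _ : Ω, -α ∂P := by simp
    rw [hconst, ← integral_add (integrable_const _) hint]
    refine integral_mono_ae ((integrable_const _).add hint)
      (hfX.integrable_condEntropy.sub hfY.integrable_condEntropy) ?_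
    -- The difference is `log s(X) - log |Y| - α + X`, and `log s ≥ 0`.
    filter_upwards [ae_pointwiseCondEntropy_eq (P := P) X (T α),
      ae_pointwiseCondEntropy_eq (P := P) Y (T α),
      ae_log_jointDensity_eq (hT α) h.ae_right_ne_zero] with ω h1 h2 h3
    rw [h1, h2, h3.1, h3.2]
    linarith [log_switchDenom_nonneg α (X ω)]
  exact tendsto_atTop_mono hlow (tendsto_neg_atBot_atTop.atTop_add tendsto_const_nhds)

end ContinuousPID

theorem mainTheorem5 {Ω : Type*} [MeasurableSpace Ω] (P : Measure Ω) [IsProbabilityMeasure P]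
    (ρ : ℝ) (hρ : ρ ∈ Set.Ioo (-1 : ℝ) 1) (X Y : Ω → ℝ) (T : ℝ → Ω → ℝ)
    (hXY : ContinuousPID.IsNormalizedGaussianPair P ρ X Y)
    (hT : ∀ α : ℝ, ContinuousPID.IsNoiseFreeInteraction
      (ContinuousPID.sigmoidalSwitch α) X Y (T α)) :
    (∀ α : ℝ, ContinuousPID.HasFiniteInformation P X (T α) ∧
      ContinuousPID.HasFiniteInformation P Y (T α)) ∧
    Tendsto (fun α : ℝ => ContinuousPID.uniqueMin P X Y (T α)) atBot (𝓝 0) ∧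
    Tendsto (fun α : ℝ => ContinuousPID.uniqueAmbiguityPM P X Y (T α)) atBot atTop ∧
    Tendsto (fun α : ℝ => ContinuousPID.uniquePM P X Y (T α)) atBot atBot := by
  have hamb := ContinuousPID.tendsto_uniqueAmbiguityPM_sigmoidalSwitch hρ hXY hT
  refine ⟨fun α => ContinuousPID.hasFiniteInformation_sigmoidalSwitch hρ hXY (hT α),
    ContinuousPID.tendsto_uniqueMin_sigmoidalSwitch hρ hXY hT, hamb, ?_⟩
  -- The unique specificity does not depend on `α`.
  exact tendsto_const_nhds.add_atBot (tendsto_neg_atTop_atBot.comp hamb)
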